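/- Let $D=(V,E)$ be a finite digraph without self-loops, with $n=|V|>1$ vertices and $m=|E|$ arcs, and let $\alpha\in[0,1]$. Let $A=A(D)$ be its $0$-$1$ adjacency matrix ($A_{uv}=1$ if and only if $u\to v$ is an arc), let $d^+(v)$ be the out-degree of the vertex $v$, let $\operatorname{Deg}(D)$ be the diagonal matrix of out-degrees, and put $A_\alpha=\alpha\operatorname{Deg}(D)+(1-\alpha)A(D)$. Let $Z=\sum_{v\in V}d^+(v)^2$, and let $c_2=\sum_{u,v\in V}A_{uv}A_{vu}$ be the number of closed walks of length $2$ in $D$. Let $\lambda_1,\dots,\lambda_n$ be the complex eigenvalues of $A_\alpha$, counted with algebraic multiplicity, let $x_i=\operatorname{Re}\lambda_i$, and let $E(D)=\sum_{i=1}^n|x_i|$ be the low energy of $A_\alpha$. Then $$E(D)\le\sqrt{n\left(\alpha^2Z+(1-\alpha)^2\,\frac{m+c_2}{2}\right)}.$$ Equality holds if and only if $A_\alpha$ is a normal matrix and $|x_1|=|x_2|=\dots=|x_n|$. In particular: (i) if $\alpha=0$, equality holds if and only if $D$ is empty (has no arcs) or $n$ is even and $D$ is isomorphic to the disjoint union of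 $n/2$ digons (a digon consists of two vertices joined by arcs in both directions); (ii) if $0<\alpha<1$, equality holds if and only if $D$ is empty; (iii) if $\alpha=1$, equality holds if and only if $D$ is out-regular, that is, $d^+(v)$ is the same for all $v\in V$. -/

import Mathlib

namespace Digraph

variable {V : Type*}

/-- The digraph on `Fin k × Fin 2` that is the disjoint union of `k` digons: the two vertices of
each pair are joined by arcs in both directions, and there are no other arcs. -/
def digonUnion (k : ℕ) : Digraph (Fin k × Fin 2) where
  Adj p q := p.1 = q.1 ∧ p.2 ≠ q.2

variable [Fintype V] (D : Digraph V) [DecidableRel D.Adj]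

/-- The out-degree of the vertex `u`. -/
def outDegree (u : V) : ℕ :=
  (Finset.univ.filter fun v : V => D.Adj u v).card

/-- The size of `D`: its number of arcs. -/
def size : ℕ :=
  (Finset.univ.filter fun p : V × V => D.Adj p.1 p.2).card

/-- The real adjacency matrix of `D`. -/
def adjMat : Matrix V V ℝ :=
  Matrix.of fun u v => if D.Adj u v then 1 else 0

/-- The first out-degree Zagreb index, the sum of the squares of the out-degrees. -/
def zagreb : ℝ :=
  ∑ v : V, (D.outDegree v : ℝ) ^ 2

/-- The number of closed walks of length two, i.e. the sum of `A u v * A v u` over the pairs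
`(u, v)` joined by an arc in at least one direction. -/
def closedWalksTwo : ℝ :=
  ∑ u : V, ∑ v ∈ Finset.univ.filter (fun v : V => D.Adj u v ∨ D.Adj v u),
    D.adjMat u v * D.adjMat v u

/-- Every vertex has the same out-degree. -/
def IsOutRegular : Prop :=
  ∃ d : ℕ, ∀ v : V, D.outDegree v = d

variable [DecidableEq V] (α : ℝ)

/-- The diagonal matrix of the out-degrees. -/
def degMat : Matrix V V ℝ :=
  Matrix.diagonal fun v => (D.outDegree v : ℝ)

/-- The `A_α`-matrix of `D`. -/
def alphaMatrix : Matrix V V ℝ :=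
  α • D.degMat + (1 - α) • D.adjMat

/-- The multiset of the complex eigenvalues of the `A_α`-matrix, with algebraic multiplicity. -/
noncomputable def alphaSpectrum : Multiset ℂ :=
  ((D.alphaMatrix α).map (algebraMap ℝ ℂ)).charpoly.roots

/-- The low energy: the sum of the absolute values of the real parts of the eigenvalues of the
`A_α`-matrix, with algebraic multiplicity. -/
noncomputable def lowEnergy : ℝ :=
  ((D.alphaSpectrum α).map fun z => |z.re|).sum

end Digraph

open Matrix

/-! ### Schur triangularisation -/

section Schur

open scoped InnerProductSpace

/-! Put `S = M + Mᴴ` for `M = A_α` and write `M = U T Uᴴ` with `U` unitary and `T` upper triangular.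
Then `tr S²` is the squared Frobenius norm of `T + Tᴴ`, whose diagonal contributes `4 ∑ xᵢ²`; the
off-diagonal rest vanishes iff `T` is diagonal, iff `M` is normal (`Matrix.exists_eigenvalues_re`).
Cauchy–Schwarz then bounds `(∑ |xᵢ|)²` by `n tr S² / 4` (`Matrix.sum_abs_re_roots_le`), and counting
arcs evaluates the trace (`trace_alphaMatrix_add_transpose_sq`).

For normal `M`, equality of all `|xᵢ|` amounts to `S²` being scalar. This eliminates the spectrum:
`S` is entrywise nonnegative, so a scalar `S²` forbids walks of length two in `S` between distinct
vertices, and the special cases become combinatorial. -/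

theorem exists_orthonormal_triangular (n : ℕ) : ∀ (E : Type*) [NormedAddCommGroup E]
    [InnerProductSpace ℂ E] [FiniteDimensional ℂ E] (T : E →ₗ[ℂ] E),
    Module.finrank ℂ E = n →
    ∃ b : Fin n → E, Orthonormal ℂ b ∧ ∀ i j, j < i → ⟪b i, T (b j)⟫_ℂ = 0 := by
  induction n with
  | zero =>
    intro E _ _ _ T _
    exact ⟨Fin.elim0, ⟨fun i => i.elim0, fun i => i.elim0⟩, fun i => i.elim0⟩
  | succ n ih =>
    intro E _ _ _ T hE
    have : Nontrivial E := Module.nontrivial_of_finrank_pos (R := ℂ) (by omega)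
    obtain ⟨μ, hμ⟩ := Module.End.exists_eigenvalue T
    obtain ⟨w, hw⟩ := hμ.exists_hasEigenvector
    have hw0 : w ≠ 0 := hw.2
    obtain ⟨v, hv1, hv⟩ : ∃ v : E, ‖v‖ = 1 ∧ T v = μ • v := by
      refine ⟨((‖w‖⁻¹ : ℝ) : ℂ) • w, ?_, ?_⟩
      · rw [norm_smul]
        simp [hw0]
      · rw [map_smul, hw.apply_eq_smul, smul_comm]
    have hv0 : v ≠ 0 := by
      rintro rfl
      simp at hv1
    -- `F` need not be `T`-invariant, so the induction uses the compression of `T` to `F`; inner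
    -- products against vectors of `F` do not see the difference.
    let F := (ℂ ∙ v)ᗮ
    have hF : Module.finrank ℂ F = n :=
      have : Fact (Module.finrank ℂ E = n + 1) := ⟨hE⟩
      Submodule.finrank_orthogonal_span_singleton hv0
    obtain ⟨b, hb, hbT⟩ := ih F
      ((F.orthogonalProjectionOnto : E →ₗ[ℂ] F) ∘ₗ T ∘ₗ F.subtype) hF
    have hvb : ∀ i, ⟪(b i : E), v⟫_ℂ = 0 := fun i =>
      Submodule.mem_orthogonal_singleton_iff_inner_left.1 (b i).2
    refine ⟨Fin.cons v (fun i => (b i : E)), ?_, ?_⟩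
    · rw [orthonormal_iff_ite]
      rw [orthonormal_iff_ite] at hb
      intro i j
      refine Fin.cases ?_ (fun i => ?_) i <;> refine Fin.cases ?_ (fun j => ?_) j
      · simp [inner_self_eq_norm_sq_to_K, hv1]
      · simp [inner_eq_zero_symm.1 (hvb j), (Fin.succ_ne_zero j).symm]
      · simp [hvb i]
      · simpa using hb i j
    · intro i j
      refine Fin.cases ?_ (fun i => ?_) i <;> refine Fin.cases ?_ (fun j => ?_) j
      · simp
      · simp
      · intro _
        simp [hv, hvb i]
      · intro h
        have := hbT i j (by simpa using h)
        simpa using this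

/-- Schur triangularisation of a complex square matrix. -/
theorem Matrix.exists_schur_triangulation {V : Type*} [Fintype V] [DecidableEq V]
    (M : Matrix V V ℂ) :
    ∃ (U : Matrix V (Fin (Fintype.card V)) ℂ)
      (T : Matrix (Fin (Fintype.card V)) (Fin (Fintype.card V)) ℂ),
      Uᴴ * U = 1 ∧ U * Uᴴ = 1 ∧ M = U * T * Uᴴ ∧ T.BlockTriangular id ∧
      M.charpoly.roots = Finset.univ.val.map fun i => T i i := by
  obtain ⟨b, hb, hbT⟩ := exists_orthonormal_triangular (Fintype.card V) (EuclideanSpace ℂ V)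
    (Matrix.toEuclideanLin M) (by simp)
  let U : Matrix V (Fin (Fintype.card V)) ℂ := Matrix.of fun v j => b j v
  have hU : Uᴴ * U = 1 := by
    ext i j
    rw [orthonormal_iff_ite] at hb
    rw [Matrix.one_apply, ← hb i j, PiLp.inner_apply]
    simp [U, Matrix.mul_apply, mul_comm]
  have hU' : U * Uᴴ = 1 := by
    rwa [Matrix.mul_eq_one_comm_of_card_eq]
    simp
  have htri : (Uᴴ * M * U).BlockTriangular id := by
    intro i j hij
    have := hbT i j hij
    rw [PiLp.inner_apply] at this
    rw [← this, Matrix.mul_assoc, Matrix.mul_apply]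
    simp [U, Matrix.mul_apply, Matrix.mulVec, dotProduct, Matrix.toLpLin_apply, mul_comm]
  have hM : M = U * (Uᴴ * M * U) * Uᴴ := by
    calc M = (U * Uᴴ) * M * (U * Uᴴ) := by simp [hU']
      _ = _ := by simp only [Matrix.mul_assoc]
  refine ⟨U, Uᴴ * M * U, hU, hU', hM, htri, ?_⟩
  have hc : M.charpoly = (Uᴴ * M * U).charpoly := by
    have h := Matrix.charpoly_mul_comm_of_le (Uᴴ * M) U (by simp)
    simp only [Fintype.card_fin, Nat.sub_self, pow_zero, one_mul] at h
    rw [h, ← Matrix.mul_assoc, hU', Matrix.one_mul]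
  rw [hc, Matrix.charpoly_of_isUpperTriangular _ htri]
  rw [Polynomial.roots_prod _ _ (Finset.prod_ne_zero_iff.2 fun i _ => Polynomial.X_sub_C_ne_zero _)]
  simp only [Polynomial.roots_X_sub_C, Multiset.bind_singleton]

theorem Matrix.mul_conjTranspose_apply_self {m n : Type*} [Fintype n] (T : Matrix m n ℂ) (i : m) :
    (T * Tᴴ) i i = ((∑ j, Complex.normSq (T i j) : ℝ) : ℂ) := by
  simp [Matrix.mul_apply, Complex.mul_conj]

theorem Matrix.conjTranspose_mul_apply_self {m n : Type*} [Fintype m] (T : Matrix m n ℂ) (i : n) :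
    (Tᴴ * T) i i = ((∑ j, Complex.normSq (T j i) : ℝ) : ℂ) := by
  simp [Matrix.mul_apply, Complex.normSq_eq_conj_mul_self]

/-- A normal upper triangular matrix is diagonal. -/
theorem Matrix.BlockTriangular.isDiag_of_isStarNormal {n : ℕ} {T : Matrix (Fin n) (Fin n) ℂ}
    (hT : T.BlockTriangular id) (hN : IsStarNormal T) : T.IsDiag := by
  -- Once the earlier rows are known to be diagonal, column `i` has only its diagonal entry.
  -- Normality gives row `i` the same norm as column `i`, so the rest of row `i` vanishes.
  have key : ∀ i : Fin n, ∀ j, i < j → T i j = 0 := by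
    intro i
    induction i using WellFoundedLT.induction with
    | ind i ih =>
      have hc : Tᴴ * T = T * Tᴴ := hN.star_comm_self
      have hsum : ∑ j, Complex.normSq (T j i) = ∑ j, Complex.normSq (T i j) := by
        have := congrFun (congrFun hc i) i
        rw [Matrix.mul_conjTranspose_apply_self, Matrix.conjTranspose_mul_apply_self] at this
        exact_mod_cast this
      have hcol : ∑ j, Complex.normSq (T j i) = Complex.normSq (T i i) := by
        refine Finset.sum_eq_single i (fun j _ hj => ?_) (by simp)
        rcases lt_or_gt_of_ne hj with h | h
        · simp [ih j h i h]
        · simp [hT h]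
      rw [hcol, ← Finset.add_sum_erase _ _ (Finset.mem_univ i), left_eq_add,
        Finset.sum_eq_zero_iff_of_nonneg (fun _ _ => Complex.normSq_nonneg _)] at hsum
      intro j hj
      exact Complex.normSq_eq_zero.1 (hsum j (by simp [hj.ne']))
  intro i j hij
  rcases lt_or_gt_of_ne hij with h | h
  · exact key i j h
  · exact hT h

/-- If `T` is upper triangular and `T + Tᴴ` is diagonal, then `T` is diagonal. -/
theorem Matrix.BlockTriangular.isDiag_of_add_conjTranspose {n : ℕ}
    {T : Matrix (Fin n) (Fin n) ℂ} (hT : T.BlockTriangular id) (h : (T + Tᴴ).IsDiag) :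
    T.IsDiag := by
  intro i j hij
  rcases lt_or_gt_of_ne hij with h' | h'
  · have := h hij
    simpa [Matrix.add_apply, hT (show id i < id j from h')] using this
  · exact hT h'

theorem Matrix.IsDiag.isStarNormal {n : Type*} [Fintype n] [DecidableEq n] {T : Matrix n n ℂ}
    (h : T.IsDiag) : IsStarNormal T := by
  rw [← h.diagonal_diag]
  refine ⟨?_⟩
  rw [Matrix.star_eq_conjTranspose, Matrix.diagonal_conjTranspose]
  exact (Matrix.commute_diagonal _ _)

end Schur

/-! ### Conjugation by a unitary matrix -/

section UnitaryConjugation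

variable {V ι : Type*} [Fintype ι]
  {U : Matrix V ι ℂ}

theorem Matrix.conj_mul_conj [Fintype V] [DecidableEq ι] (hU : Uᴴ * U = 1) (S T : Matrix ι ι ℂ) :
    (U * S * Uᴴ) * (U * T * Uᴴ) = U * (S * T) * Uᴴ := by
  calc (U * S * Uᴴ) * (U * T * Uᴴ) = U * S * (Uᴴ * U) * T * Uᴴ := by
        simp only [Matrix.mul_assoc]
    _ = _ := by rw [hU, Matrix.mul_one]; simp only [Matrix.mul_assoc]

theorem Matrix.conj_injective [Fintype V] [DecidableEq ι] (hU : Uᴴ * U = 1) :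
    Function.Injective fun T : Matrix ι ι ℂ => U * T * Uᴴ := by
  intro S T h
  have key : ∀ R : Matrix ι ι ℂ, Uᴴ * (U * R * Uᴴ) * U = R := fun R => by
    calc Uᴴ * (U * R * Uᴴ) * U = (Uᴴ * U) * R * (Uᴴ * U) := by simp only [Matrix.mul_assoc]
      _ = R := by simp [hU]
  rw [← key S, ← key T]
  exact congrArg (fun X => Uᴴ * X * U) h

theorem Matrix.conj_conjTranspose (T : Matrix ι ι ℂ) : (U * T * Uᴴ)ᴴ = U * Tᴴ * Uᴴ := by
  simp [Matrix.mul_assoc]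

theorem Matrix.isStarNormal_conj [Fintype V] [DecidableEq ι] (hU : Uᴴ * U = 1) (T : Matrix ι ι ℂ) :
    IsStarNormal (U * T * Uᴴ) ↔ IsStarNormal T := by
  simp only [isStarNormal_iff, Matrix.star_eq_conjTranspose, Commute, SemiconjBy,
    Matrix.conj_conjTranspose, Matrix.conj_mul_conj hU]
  exact (Matrix.conj_injective hU).eq_iff

theorem Matrix.conj_add_conjTranspose (T : Matrix ι ι ℂ) :
    U * T * Uᴴ + (U * T * Uᴴ)ᴴ = U * (T + Tᴴ) * Uᴴ := by
  rw [Matrix.conj_conjTranspose, Matrix.mul_add, Matrix.add_mul]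

end UnitaryConjugation

/-! ### Real parts of eigenvalues -/

section RealParts

variable {V : Type*} [Fintype V] [DecidableEq V]

theorem Matrix.trace_add_conjTranspose_sq {ι : Type*} [Fintype ι] (T : Matrix ι ι ℂ) :
    ((T + Tᴴ) * (T + Tᴴ)).trace = ((∑ i, ∑ j, Complex.normSq ((T + Tᴴ) i j) : ℝ) : ℂ) := by
  have h : (T + Tᴴ)ᴴ = T + Tᴴ := by rw [conjTranspose_add, conjTranspose_conjTranspose, add_comm]
  -- Writing the square as a matrix times its adjoint makes the trace a Frobenius norm.
  nth_rewrite 2 [← h]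
  rw [Matrix.trace, Complex.ofReal_sum]
  exact Finset.sum_congr rfl fun i _ => Matrix.mul_conjTranspose_apply_self _ i

/-- The real parts `x i` of the eigenvalues of a complex matrix `M` satisfy
`4 ∑ (x i)² ≤ tr ((M + Mᴴ)²)`, with equality exactly for normal `M`; for normal `M`, they all have
the same absolute value exactly if `(M + Mᴴ)²` is scalar. -/
theorem Matrix.exists_eigenvalues_re (M : Matrix V V ℂ) :
    ∃ z : Fin (Fintype.card V) → ℂ, M.charpoly.roots = Finset.univ.val.map z ∧
      4 * ∑ i, (z i).re ^ 2 ≤ ((M + Mᴴ) * (M + Mᴴ)).trace.re ∧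
      (4 * ∑ i, (z i).re ^ 2 = ((M + Mᴴ) * (M + Mᴴ)).trace.re ↔ IsStarNormal M) ∧
      (IsStarNormal M → ((∀ i j, |(z i).re| = |(z j).re|) ↔
        ∃ c : ℂ, (M + Mᴴ) * (M + Mᴴ) = c • 1)) := by
  obtain ⟨U, T, hU, hU', hM, hT, hroots⟩ := M.exists_schur_triangulation
  have hsq : (M + Mᴴ) * (M + Mᴴ) = U * ((T + Tᴴ) * (T + Tᴴ)) * Uᴴ := by
    rw [hM, Matrix.conj_add_conjTranspose, Matrix.conj_mul_conj hU]
  have htr : ((M + Mᴴ) * (M + Mᴴ)).trace.re = ∑ i, ∑ j, Complex.normSq ((T + Tᴴ) i j) := by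
    rw [hsq, Matrix.trace_mul_comm, ← Matrix.mul_assoc, hU, Matrix.one_mul,
      Matrix.trace_add_conjTranspose_sq, Complex.ofReal_re]
  have hnorm : IsStarNormal M ↔ IsStarNormal T := by rw [hM, Matrix.isStarNormal_conj hU]
  have hdiag : ∀ i, (T + Tᴴ) i i = ((2 * (T i i).re : ℝ) : ℂ) := fun i => by
    simp [Matrix.add_apply, Complex.add_conj]
  have hdiag' : ∀ i, Complex.normSq ((T + Tᴴ) i i) = 4 * (T i i).re ^ 2 := fun i => by
    rw [hdiag, Complex.normSq_ofReal]
    ring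
  have hrow : ∀ i, ∑ j, Complex.normSq ((T + Tᴴ) i j) = 4 * (T i i).re ^ 2 +
      ∑ j ∈ Finset.univ.erase i, Complex.normSq ((T + Tᴴ) i j) := fun i => by
    rw [← hdiag']
    exact (Finset.add_sum_erase _ (fun j => Complex.normSq ((T + Tᴴ) i j))
      (Finset.mem_univ i)).symm
  have htotal : ((M + Mᴴ) * (M + Mᴴ)).trace.re = 4 * ∑ i, (T i i).re ^ 2 +
      ∑ i, ∑ j ∈ Finset.univ.erase i, Complex.normSq ((T + Tᴴ) i j) := by
    rw [htr, Finset.mul_sum, ← Finset.sum_add_distrib]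
    exact Finset.sum_congr rfl fun i _ => hrow i
  have hoff : ∀ i, 0 ≤ ∑ j ∈ Finset.univ.erase i, Complex.normSq ((T + Tᴴ) i j) := fun i =>
    Finset.sum_nonneg fun _ _ => Complex.normSq_nonneg _
  refine ⟨fun i => T i i, hroots, ?_, ?_, ?_⟩
  · rw [htotal]
    exact le_add_of_nonneg_right (Finset.sum_nonneg fun i _ => hoff i)
  · rw [htotal, left_eq_add, Finset.sum_eq_zero_iff_of_nonneg (fun i _ => hoff i), hnorm]
    constructor
    · intro h
      refine (hT.isDiag_of_add_conjTranspose fun i j hij => ?_).isStarNormal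
      have := (Finset.sum_eq_zero_iff_of_nonneg fun _ _ => Complex.normSq_nonneg _).1
        (h i (Finset.mem_univ i)) j (by simp [hij.symm])
      exact Complex.normSq_eq_zero.1 this
    · intro h i _
      have hd := hT.isDiag_of_isStarNormal h
      refine Finset.sum_eq_zero fun j hj => ?_
      have hij : i ≠ j := (Finset.ne_of_mem_erase hj).symm
      simp [hd hij, hd hij.symm]
  · intro h
    have hd := hT.isDiag_of_isStarNormal (hnorm.1 h)
    have hS : T + Tᴴ = diagonal fun i => ((2 * (T i i).re : ℝ) : ℂ) := by
      ext i j
      by_cases hij : i = j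
      · subst hij
        rw [hdiag, diagonal_apply_eq]
      · rw [diagonal_apply_ne _ hij]
        simp [hd hij, hd (Ne.symm hij)]
    have hc : ∀ c : ℂ, c • (1 : Matrix V V ℂ) =
        U * (c • (1 : Matrix (Fin (Fintype.card V)) (Fin (Fintype.card V)) ℂ)) * Uᴴ := fun c => by
      simp [hU']
    have hS2 : (T + Tᴴ) * (T + Tᴴ) = diagonal fun i => ((4 * (T i i).re ^ 2 : ℝ) : ℂ) := by
      rw [hS, diagonal_mul_diagonal]
      congr 1
      ext i
      push_cast
      ring
    simp only [hsq, hc, (Matrix.conj_injective hU).eq_iff, hS2, smul_one_eq_diagonal,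
      diagonal_eq_diagonal_iff]
    constructor
    · intro heq
      by_cases hne : Nonempty (Fin (Fintype.card V))
      · obtain ⟨i₀⟩ := hne
        refine ⟨((4 * (T i₀ i₀).re ^ 2 : ℝ) : ℂ), fun i => ?_⟩
        rw [sq_eq_sq_iff_abs_eq_abs _ _ |>.2 (heq i i₀)]
      · exact ⟨0, fun i => (hne ⟨i⟩).elim⟩
    · rintro ⟨c, hc⟩ i j
      have : (4 * (T i i).re ^ 2 : ℝ) = 4 * (T j j).re ^ 2 := by
        exact_mod_cast (hc i).trans (hc j).symm
      exact (sq_eq_sq_iff_abs_eq_abs _ _).1 (by linarith)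

/-- The sum of the absolute values of the real parts of the eigenvalues of a real matrix, compared
with the square root of `n * tr ((M + Mᵀ)²) / 4`. -/
theorem Matrix.sum_abs_re_roots_le (M : Matrix V V ℝ) (hV : 0 < Fintype.card V) {Q B : ℝ}
    (hQ : ((M + Mᵀ) * (M + Mᵀ)).trace = 4 * Q) (hB : B = √((Fintype.card V : ℝ) * Q)) :
    (((M.map (algebraMap ℝ ℂ)).charpoly.roots.map fun z => |z.re|).sum ≤ B) ∧
    ((((M.map (algebraMap ℝ ℂ)).charpoly.roots.map fun z => |z.re|).sum = B) ↔
      IsStarNormal M ∧ ∀ z ∈ (M.map (algebraMap ℝ ℂ)).charpoly.roots,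
        ∀ w ∈ (M.map (algebraMap ℝ ℂ)).charpoly.roots, |z.re| = |w.re|) ∧
    ((((M.map (algebraMap ℝ ℂ)).charpoly.roots.map fun z => |z.re|).sum = B) ↔
      IsStarNormal M ∧ ∃ c : ℝ, (M + Mᵀ) * (M + Mᵀ) = c • 1) := by
  set N := M.map (algebraMap ℝ ℂ) with hNdef
  have hinj : Function.Injective fun X : Matrix V V ℝ => X.map (algebraMap ℝ ℂ) :=
    Matrix.map_injective (algebraMap ℝ ℂ).injective
  have hNH : Nᴴ = Mᵀ.map (algebraMap ℝ ℂ) := by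
    ext i j
    simp [N]
  have hsq : (N + Nᴴ) * (N + Nᴴ) = ((M + Mᵀ) * (M + Mᵀ)).map (algebraMap ℝ ℂ) := by
    rw [hNH, hNdef, Matrix.map_mul, Matrix.map_add _ (map_add _)]
  have htr : ((N + Nᴴ) * (N + Nᴴ)).trace.re = 4 * Q := by
    rw [hsq, ← hQ, Matrix.trace, Matrix.trace, Complex.re_sum]
    simp
  have hnormal : IsStarNormal N ↔ IsStarNormal M := by
    simp only [isStarNormal_iff, Matrix.star_eq_conjTranspose, Commute, SemiconjBy, hNH]
    rw [hNdef, ← Matrix.map_mul, ← Matrix.map_mul, hinj.eq_iff, conjTranspose_eq_transpose_of_trivial]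
  have hscalar : (∃ c : ℂ, (N + Nᴴ) * (N + Nᴴ) = c • 1) ↔
      ∃ c : ℝ, (M + Mᵀ) * (M + Mᵀ) = c • 1 := by
    have hreal : ∀ c : ℝ, ((c : ℝ) • (1 : Matrix V V ℝ)).map (algebraMap ℝ ℂ) = (c : ℂ) • 1 := by
      intro c
      ext i j
      by_cases hij : i = j <;> simp [hij]
    constructor
    · rintro ⟨c, hc⟩
      obtain ⟨v⟩ := Fintype.card_pos_iff.1 hV
      -- The complex scalar is real because it is a diagonal entry of a real matrix.
      refine ⟨((M + Mᵀ) * (M + Mᵀ)) v v, hinj ?_⟩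
      have hv := congrFun (congrFun hc v) v
      rw [hsq] at hv
      simp only [Matrix.map_apply, Matrix.smul_apply, Matrix.one_apply_eq, smul_eq_mul,
        mul_one] at hv
      change ((M + Mᵀ) * (M + Mᵀ)).map (algebraMap ℝ ℂ) = Matrix.map _ (algebraMap ℝ ℂ)
      rw [hreal, ← hsq, hc, ← hv]
      rfl
    · rintro ⟨c, hc⟩
      exact ⟨c, by rw [hsq, hc, hreal]⟩
  obtain ⟨z, hz, hle, heq, hsc⟩ := N.exists_eigenvalues_re
  rw [htr] at hle heq
  rw [hnormal] at heq hsc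
  rw [hscalar] at hsc
  have hall : (∀ y ∈ N.charpoly.roots, ∀ w ∈ N.charpoly.roots, |y.re| = |w.re|) ↔
      ∀ i j, |(z i).re| = |(z j).re| := by
    simp [hz]
  have hsum : (N.charpoly.roots.map fun y => |y.re|).sum = ∑ i, |(z i).re| := by
    rw [hz, Multiset.map_map]
    rfl
  rw [hall, hsum]
  set n : ℝ := (Fintype.card V : ℝ) with hn
  have hnpos : 0 < n := Nat.cast_pos.2 hV
  -- Lagrange's identity: the explicit Cauchy–Schwarz defect gives both the inequality and its
  -- equality case.
  have hvar : n * ∑ i, (z i).re ^ 2 - (∑ i, |(z i).re|) ^ 2 =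
      (∑ i, ∑ j, (|(z i).re| - |(z j).re|) ^ 2) / 2 := by
    have : ∀ i j, (|(z i).re| - |(z j).re|) ^ 2 =
        (z i).re ^ 2 + (z j).re ^ 2 - 2 * (|(z i).re| * |(z j).re|) := fun i j => by
      rw [sub_sq, sq_abs, sq_abs]
      ring
    simp only [this, Finset.sum_sub_distrib, Finset.sum_add_distrib, Finset.sum_const,
      ← Finset.mul_sum, ← Finset.sum_mul, Finset.card_univ, Fintype.card_fin, nsmul_eq_mul, ← hn]
    ring
  have hvar_nonneg : 0 ≤ ∑ i, ∑ j, (|(z i).re| - |(z j).re|) ^ 2 :=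
    Finset.sum_nonneg fun i _ => Finset.sum_nonneg fun j _ => sq_nonneg _
  have hvar_zero : ∑ i, ∑ j, (|(z i).re| - |(z j).re|) ^ 2 = 0 ↔
      ∀ i j, |(z i).re| = |(z j).re| := by
    rw [Finset.sum_eq_zero_iff_of_nonneg fun i _ => Finset.sum_nonneg fun j _ => sq_nonneg _]
    refine forall_congr' fun i => ?_
    rw [Finset.sum_eq_zero_iff_of_nonneg fun j _ => sq_nonneg _]
    simp [sub_eq_zero]
  have hE0 : 0 ≤ ∑ i, |(z i).re| := Finset.sum_nonneg fun i _ => abs_nonneg _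
  have hmul : n * ∑ i, (z i).re ^ 2 ≤ n * Q :=
    mul_le_mul_of_nonneg_left (by linarith) hnpos.le
  have hEB : ∑ i, |(z i).re| = B ↔ (∑ i, |(z i).re|) ^ 2 = n * Q := by
    have hnQ : 0 ≤ n * Q := by linarith [sq_nonneg (∑ i, |(z i).re|)]
    rw [hB, eq_comm, Real.sqrt_eq_iff_eq_sq hnQ hE0, eq_comm]
  have hmain : ∑ i, |(z i).re| = B ↔ IsStarNormal M ∧ ∀ i j, |(z i).re| = |(z j).re| := by
    rw [hEB, ← heq, ← hvar_zero]
    constructor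
    · intro h
      have h1 : n * ∑ i, (z i).re ^ 2 = n * Q := by linarith
      have h2 := mul_left_cancel₀ hnpos.ne' h1
      constructor <;> linarith
    · rintro ⟨h1, h2⟩
      have h3 : ∑ i, (z i).re ^ 2 = Q := by linarith
      rw [h3, h2] at hvar
      linarith
  refine ⟨?_, hmain, hmain.trans (and_congr_right fun h => hsc h)⟩
  rw [hB]
  exact Real.le_sqrt_of_sq_le (by linarith)

end RealParts

/-! ### The trace for a digraph -/

namespace Digraph

variable {V : Type*} (D : Digraph V) [DecidableRel D.Adj]

theorem adjMat_apply (u v : V) : D.adjMat u v = if D.Adj u v then 1 else 0 := rfl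

theorem adjMat_sq (u v : V) : D.adjMat u v ^ 2 = D.adjMat u v := by
  rw [adjMat_apply]
  split_ifs <;> norm_num

theorem adjMat_nonneg (u v : V) : 0 ≤ D.adjMat u v := by
  rw [adjMat_apply]
  split_ifs <;> norm_num

variable [Fintype V]

theorem size_eq_sum : (D.size : ℝ) = ∑ u, ∑ v, D.adjMat u v := by
  have h := Fintype.sum_prod_type' D.adjMat
  rw [← h]
  simp [size, adjMat_apply]

theorem closedWalksTwo_eq_sum : D.closedWalksTwo = ∑ u, ∑ v, D.adjMat u v * D.adjMat v u := by
  refine Finset.sum_congr rfl fun u _ => Finset.sum_subset (Finset.filter_subset _ _) ?_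
  intro v _ hv
  have h : ¬ D.Adj u v := fun h => hv (by simp [h])
  simp [adjMat_apply, h]

variable {D}

theorem outDegree_eq_zero (h : ∀ u v, ¬ D.Adj u v) (u : V) : D.outDegree u = 0 := by
  simp [outDegree, h]

variable [DecidableEq V]

theorem alphaMatrix_add_transpose_apply_self (hloop : ∀ v, ¬ D.Adj v v) (α : ℝ) (u : V) :
    (D.alphaMatrix α + (D.alphaMatrix α)ᵀ) u u = 2 * α * D.outDegree u := by
  simp [alphaMatrix, degMat, adjMat_apply, hloop u]
  ring

theorem alphaMatrix_add_transpose_apply_ne (D : Digraph V) [DecidableRel D.Adj] (α : ℝ) {u v : V}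
    (h : u ≠ v) : (D.alphaMatrix α + (D.alphaMatrix α)ᵀ) u v =
      (1 - α) * (D.adjMat u v + D.adjMat v u) := by
  simp [alphaMatrix, degMat, Matrix.diagonal_apply_ne _ h]
  ring

theorem trace_alphaMatrix_add_transpose_sq (hloop : ∀ v, ¬ D.Adj v v) (α : ℝ) :
    ((D.alphaMatrix α + (D.alphaMatrix α)ᵀ) * (D.alphaMatrix α + (D.alphaMatrix α)ᵀ)).trace =
      4 * (α ^ 2 * D.zagreb + (1 - α) ^ 2 * (((D.size : ℝ) + D.closedWalksTwo) / 2)) := by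
  set S := D.alphaMatrix α + (D.alphaMatrix α)ᵀ with hS
  have hsymm : ∀ u v, S v u = S u v := fun u v => by simp [hS, add_comm]
  -- Entries `a`, `b` in `{0, 1}` satisfy `(a + b)² = a + b + 2ab`; on the diagonal these terms
  -- vanish as there are no loops.
  have hentry : ∀ u v, S u v * S v u = (if u = v then 4 * α ^ 2 * (D.outDegree u : ℝ) ^ 2 else 0) +
      (1 - α) ^ 2 * (D.adjMat u v + D.adjMat v u + 2 * (D.adjMat u v * D.adjMat v u)) := by
    intro u v
    rw [hsymm u v]
    by_cases h : u = v
    · subst h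
      have hz : D.adjMat u u = 0 := by simp [adjMat_apply, hloop u]
      rw [hS, alphaMatrix_add_transpose_apply_self hloop, hz, if_pos rfl]
      ring
    · rw [hS, alphaMatrix_add_transpose_apply_ne D α h, if_neg h]
      linear_combination (1 - α) ^ 2 * (D.adjMat_sq u v + D.adjMat_sq v u)
  have hsize : (D.size : ℝ) = ∑ u, ∑ v, D.adjMat v u := by
    rw [size_eq_sum, Finset.sum_comm]
  simp only [Matrix.trace, Matrix.diag, Matrix.mul_apply, hentry, Finset.sum_add_distrib,
    ← Finset.mul_sum, ← hsize, ← size_eq_sum, ← closedWalksTwo_eq_sum, Finset.sum_ite_eq,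
    Finset.mem_univ, if_true, zagreb]
  ring

theorem alphaMatrix_eq_zero (h : ∀ u v, ¬ D.Adj u v) (α : ℝ) : D.alphaMatrix α = 0 := by
  ext u v
  simp [alphaMatrix, degMat, outDegree_eq_zero h, adjMat_apply, h]

theorem alphaMatrix_zero (D : Digraph V) [DecidableRel D.Adj] : D.alphaMatrix 0 = D.adjMat := by
  simp [alphaMatrix]

theorem alphaMatrix_one (D : Digraph V) [DecidableRel D.Adj] : D.alphaMatrix 1 = D.degMat := by
  simp [alphaMatrix]

/-! ### Combinatorial form of the scalar condition -/

theorem isStarNormal_and_scalar_of_isEmpty (h : ∀ u v, ¬ D.Adj u v) (α : ℝ) :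
    IsStarNormal (D.alphaMatrix α) ∧ ∃ c : ℝ, (D.alphaMatrix α + (D.alphaMatrix α)ᵀ) *
      (D.alphaMatrix α + (D.alphaMatrix α)ᵀ) = c • 1 := by
  rw [alphaMatrix_eq_zero h]
  exact ⟨IsStarNormal.zero, 0, by simp⟩

theorem alphaMatrix_add_transpose_nonneg {α : ℝ} (h0 : 0 ≤ α) (h1 : α ≤ 1) (u v : V) :
    0 ≤ (D.alphaMatrix α + (D.alphaMatrix α)ᵀ) u v := by
  have key : ∀ u v, 0 ≤ D.alphaMatrix α u v := fun u v => by
    simp only [alphaMatrix, degMat, Matrix.add_apply, Matrix.smul_apply, smul_eq_mul,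
      Matrix.diagonal_apply]
    have := mul_nonneg (sub_nonneg.2 h1) (D.adjMat_nonneg u v)
    split_ifs <;> positivity
  exact add_nonneg (key u v) (key v u)

/-- If the square of an entrywise nonnegative matrix is scalar, then there is no walk of length two
between distinct vertices. -/
theorem _root_.Matrix.mul_eq_zero_of_sq_eq_smul_one {S : Matrix V V ℝ} (hS : ∀ u v, 0 ≤ S u v)
    {c : ℝ} (hc : S * S = c • 1) {u v : V} (h : u ≠ v) (w : V) : S u w * S w v = 0 := by
  have huv := congrFun (congrFun hc u) v
  rw [Matrix.mul_apply, Matrix.smul_apply, Matrix.one_apply_ne h, smul_zero,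
    Finset.sum_eq_zero_iff_of_nonneg fun w _ => mul_nonneg (hS u w) (hS w v)] at huv
  exact huv w (Finset.mem_univ w)

/-- An arc from `u` to `v` would produce the forbidden walk `u, u, v`: its first step has weight
`2αd⁺(u) > 0`, its second at least `1 - α > 0`. -/
theorem isEmpty_of_scalar (hloop : ∀ v, ¬ D.Adj v v) {α : ℝ} (h0 : 0 < α) (h1 : α < 1) {c : ℝ}
    (hc : (D.alphaMatrix α + (D.alphaMatrix α)ᵀ) *
      (D.alphaMatrix α + (D.alphaMatrix α)ᵀ) = c • 1) (u v : V) : ¬ D.Adj u v := by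
  intro huv
  have hne : u ≠ v := by
    rintro rfl
    exact hloop u huv
  have hdeg : 0 < D.outDegree u := Finset.card_pos.2 ⟨v, by simp [huv]⟩
  have hz := Matrix.mul_eq_zero_of_sq_eq_smul_one
    (alphaMatrix_add_transpose_nonneg h0.le h1.le) hc hne u
  rw [alphaMatrix_add_transpose_apply_self hloop, alphaMatrix_add_transpose_apply_ne D α hne] at hz
  have hA : D.adjMat u v = 1 := by simp [adjMat_apply, huv]
  have hA' := D.adjMat_nonneg v u
  have h1' : 0 < 1 - α := sub_pos.2 h1
  have hd : (0 : ℝ) < D.outDegree u := by exact_mod_cast hdeg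
  rw [hA] at hz
  have : 0 < 2 * α * D.outDegree u * ((1 - α) * (1 + D.adjMat v u)) := by positivity
  exact this.ne' hz

theorem isOutRegular_iff_scalar (hV : 0 < Fintype.card V) :
    (IsStarNormal (D.alphaMatrix 1) ∧ ∃ c : ℝ, (D.alphaMatrix 1 + (D.alphaMatrix 1)ᵀ) *
      (D.alphaMatrix 1 + (D.alphaMatrix 1)ᵀ) = c • 1) ↔ D.IsOutRegular := by
  have hsq : (D.alphaMatrix 1 + (D.alphaMatrix 1)ᵀ) * (D.alphaMatrix 1 + (D.alphaMatrix 1)ᵀ) =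
      diagonal fun v => 4 * (D.outDegree v : ℝ) ^ 2 := by
    rw [alphaMatrix_one, degMat, diagonal_transpose, diagonal_add, diagonal_mul_diagonal]
    congr 1
    ext v
    ring
  have hn : IsStarNormal (D.alphaMatrix 1) := by
    rw [alphaMatrix_one]
    refine ⟨?_⟩
    rw [star_eq_conjTranspose, degMat, diagonal_conjTranspose]
    exact commute_diagonal _ _
  simp only [hn, true_and, hsq, smul_one_eq_diagonal, diagonal_eq_diagonal_iff]
  constructor
  · rintro ⟨c, hc⟩
    obtain ⟨v₀⟩ := Fintype.card_pos_iff.1 hV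
    refine ⟨D.outDegree v₀, fun v => ?_⟩
    have h : (D.outDegree v : ℝ) ^ 2 = (D.outDegree v₀ : ℝ) ^ 2 := by linarith [hc v, hc v₀]
    exact_mod_cast (pow_left_inj₀ (Nat.cast_nonneg _) (Nat.cast_nonneg _) two_ne_zero).1 h
  · rintro ⟨d, hd⟩
    exact ⟨4 * (d : ℝ) ^ 2, fun v => by rw [hd v]⟩

/-- A digraph whose arcs are the pairs `(u, f u)` for a fixed point free involution `f` is a
disjoint union of digons, and conversely. -/
theorem exists_involution_iff_digonUnion {V : Type*} [Fintype V] (D : Digraph V) :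
    (∃ f : V → V, (∀ u, f (f u) = u) ∧ (∀ u, f u ≠ u) ∧ ∀ u v, D.Adj u v ↔ v = f u) ↔
      ∃ k : ℕ, Fintype.card V = 2 * k ∧ Nonempty (D.Adj ≃r (digonUnion k).Adj) := by
  classical
  constructor
  · rintro ⟨f, hff, hf, hadj⟩
    let e₀ := Fintype.equivFin V
    -- An arbitrary ordering of `V` selects one vertex from each orbit of `f`.
    let P : V → Prop := fun u => e₀ u < e₀ (f u)
    have hP : ∀ u, P (f u) ↔ ¬ P u := fun u => by
      have : e₀ (f u) ≠ e₀ u := fun h => hf u (e₀.injective h)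
      simp only [P, hff, not_lt]
      exact ⟨le_of_lt, fun h => lt_of_le_of_ne h this⟩
    let e₁ : {u // P u} ≃ Fin (Fintype.card {u // P u}) := Fintype.equivFin _
    let rep : V → {u // P u} := fun u =>
      if h : P u then ⟨u, h⟩ else ⟨f u, (hP u).2 h⟩
    have hrep : ∀ u, rep (f u) = rep u := fun u => by
      by_cases h : P u
      · have h' : ¬ P (f u) := fun h' => (hP u).1 h' h
        simp [rep, h, h', hff]
      · have h' : P (f u) := (hP u).2 h
        simp [rep, h, h']
    let e : V ≃ Fin (Fintype.card {u // P u}) × Fin 2 :=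
      { toFun := fun u => (e₁ (rep u), if P u then 0 else 1)
        invFun := fun p => if p.2 = 0 then (e₁.symm p.1 : V) else f (e₁.symm p.1)
        left_inv := fun u => by
          by_cases h : P u <;> simp [rep, h, hff]
        right_inv := fun p => by
          obtain ⟨i, j⟩ := p
          have hi : P (e₁.symm i) := (e₁.symm i).2
          have hi' : ¬ P (f (e₁.symm i)) := fun h => (hP _).1 h hi
          fin_cases j
          · simp [rep, hi]
          · simp [rep, hi', hff] }
    refine ⟨Fintype.card {u // P u}, ?_, ⟨⟨e, fun {u v} => ?_⟩⟩⟩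
    · have hcard := Fintype.card_congr e
      rwa [Fintype.card_prod, Fintype.card_fin, Fintype.card_fin, mul_comm] at hcard
    · change (e u).1 = (e v).1 ∧ (e u).2 ≠ (e v).2 ↔ D.Adj u v
      rw [hadj]
      constructor
      · rintro ⟨h1, h2⟩
        have hv : e (f u) = ((e u).1, 1 - (e u).2) := by
          by_cases h : P u
          · have h' : ¬ P (f u) := fun h' => (hP u).1 h' h
            simp [e, hrep, h, h']
          · have h' : P (f u) := (hP u).2 h
            simp [e, hrep, h, h']
        refine e.injective ?_
        rw [hv, h1]
        refine Prod.ext rfl ?_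
        change (e v).2 = 1 - (e u).2
        generalize (e v).2 = a at *
        generalize (e u).2 = b at *
        fin_cases a <;> fin_cases b <;> simp_all
      · rintro rfl
        refine ⟨congrArg e₁ (hrep u).symm, ?_⟩
        by_cases h : P u
        · have h' : ¬ P (f u) := fun h' => (hP u).1 h' h
          simp [e, h, h']
        · have h' : P (f u) := (hP u).2 h
          simp [e, h, h']
  · rintro ⟨k, _, ⟨e⟩⟩
    have hfin : ∀ a b : Fin 2, a ≠ b ↔ b = a.rev := by decide
    refine ⟨fun u => e.symm ((e u).1, (e u).2.rev), fun u => by simp, fun u h => ?_, fun u v => ?_⟩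
    · have := congrArg (fun x => (e x).2) h
      simp only [RelIso.apply_symm_apply] at this
      exact (hfin _ _).2 this.symm rfl
    · rw [← e.map_rel_iff]
      change (e u).1 = (e v).1 ∧ (e u).2 ≠ (e v).2 ↔ _
      rw [hfin, ← e.injective.eq_iff, RelIso.apply_symm_apply, Prod.ext_iff, eq_comm (a := (e u).1)]

/-- If there is an arc, the scalar is nonzero, so every vertex has a neighbour in `S`. It has only
one, since two neighbours of `u` would be joined by a walk through `u`. Thus `S` is supported on a
perfect matching, and normality makes each matched pair a digon. -/
theorem isEmpty_or_involution_iff (hloop : ∀ v, ¬ D.Adj v v) :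
    (IsStarNormal (D.alphaMatrix 0) ∧ ∃ c : ℝ, (D.alphaMatrix 0 + (D.alphaMatrix 0)ᵀ) *
      (D.alphaMatrix 0 + (D.alphaMatrix 0)ᵀ) = c • 1) ↔
    (∀ u v : V, ¬ D.Adj u v) ∨
      ∃ f : V → V, (∀ u, f (f u) = u) ∧ (∀ u, f u ≠ u) ∧ ∀ u v, D.Adj u v ↔ v = f u := by
  constructor
  · rintro ⟨hnormal, c, hc⟩
    by_cases hempty : ∀ u v, ¬ D.Adj u v
    · exact Or.inl hempty
    refine Or.inr ?_
    push Not at hempty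
    obtain ⟨a, b, hab⟩ := hempty
    have hS0 := alphaMatrix_add_transpose_nonneg (D := D) le_rfl zero_le_one
    rw [alphaMatrix_zero] at hnormal hc hS0
    set S := D.adjMat + D.adjMatᵀ with hS
    have hSapp : ∀ u v, S u v = D.adjMat u v + D.adjMat v u := fun u v => rfl
    have hsymm : ∀ u v, S u v = S v u := fun u v => add_comm _ _
    have hdiag : ∀ u, ∑ w, S u w * S w u = c := fun u => by
      have := congrFun (congrFun hc u) u
      simpa [Matrix.mul_apply] using this
    have hcpos : c ≠ 0 := by
      rw [← hdiag a]
      have h1 : 0 < S a b := by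
        rw [hSapp, adjMat_apply, if_pos hab]
        linarith [D.adjMat_nonneg b a]
      refine (lt_of_lt_of_le (mul_pos h1 ((hsymm a b) ▸ h1)) ?_).ne'
      exact Finset.single_le_sum (f := fun w => S a w * S w a)
        (fun w _ => mul_nonneg (hS0 a w) (hS0 w a)) (Finset.mem_univ b)
    have hex : ∀ u, ∃ w, S u w ≠ 0 := fun u => by
      by_contra! h
      exact hcpos (by rw [← hdiag u]; simp [h])
    choose f hf using hex
    have huniq : ∀ u w, w ≠ f u → S u w = 0 := fun u w hw => by
      have h := Matrix.mul_eq_zero_of_sq_eq_smul_one hS0 hc hw u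
      rw [hsymm w u] at h
      exact (mul_eq_zero.1 h).resolve_right (hf u)
    have hA : ∀ u w, S u w = 0 → D.adjMat u w = 0 ∧ D.adjMat w u = 0 := fun u w h => by
      have h1 := D.adjMat_nonneg u w
      have h2 := D.adjMat_nonneg w u
      rw [hSapp] at h
      constructor <;> linarith
    have hcomm : D.adjMatᵀ * D.adjMat = D.adjMat * D.adjMatᵀ := hnormal.star_comm_self
    -- The diagonal of the normality relation equates in-degree and out-degree, and each of them is
    -- a single entry here.
    have hbal : ∀ u, D.adjMat (f u) u = D.adjMat u (f u) := fun u => by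
      have h := congrFun (congrFun hcomm u) u
      simp only [Matrix.mul_apply, Matrix.transpose_apply, ← sq, adjMat_sq] at h
      rwa [Finset.sum_eq_single (f u) (fun w _ hw => (hA u w (huniq u w hw)).2) (by simp),
        Finset.sum_eq_single (f u) (fun w _ hw => (hA u w (huniq u w hw)).1) (by simp)] at h
    have hadj : ∀ u v, D.Adj u v ↔ v = f u := fun u v => by
      constructor
      · intro h
        by_contra hne
        have := (hA u v (huniq u v hne)).1
        simp [adjMat_apply, h] at this
      · rintro rfl
        by_contra h
        have h1 : D.adjMat u (f u) = 0 := by simp [adjMat_apply, h]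
        exact hf u (by rw [hSapp, hbal, h1, add_zero])
    refine ⟨f, fun u => ?_, fun u h => ?_, hadj⟩
    · by_contra h
      exact hf u (by rw [hsymm]; exact huniq (f u) u (Ne.symm h))
    · exact hloop u ((hadj u u).2 h.symm)
  · rintro (h | ⟨f, hff, -, hadj⟩)
    · exact isStarNormal_and_scalar_of_isEmpty h 0
    · rw [alphaMatrix_zero]
      have hT : D.adjMatᵀ = D.adjMat := by
        ext u v
        have : u = f v ↔ v = f u := by
          constructor <;> rintro rfl <;> rw [hff]
        simp only [Matrix.transpose_apply, adjMat_apply, hadj, this]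
      have hsq : D.adjMat * D.adjMat = 1 := by
        ext u v
        rw [Matrix.mul_apply, Finset.sum_eq_single (f u)]
        · simp [adjMat_apply, hadj, hff, Matrix.one_apply, eq_comm (a := v)]
        · intro w _ hw
          simp [adjMat_apply, hadj, hw]
        · simp
      -- The adjacency matrix `A` is symmetric with `A² = 1`, hence `(A + Aᵀ)² = 4`.
      refine ⟨⟨?_⟩, 4, ?_⟩
      · rw [star_eq_conjTranspose, conjTranspose_eq_transpose_of_trivial, hT]
      · rw [hT, Matrix.add_mul, Matrix.mul_add, hsq]
        module

end Digraph

theorem corollary4p2 {V : Type*} [Fintype V] [DecidableEq V] (D : Digraph V)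
    [DecidableRel D.Adj] (hloop : ∀ v : V, ¬ D.Adj v v) (hn : 1 < Fintype.card V)
    (α : ℝ) (hα : α ∈ Set.Icc (0 : ℝ) 1) (B : ℝ)
    (hB : B = √((Fintype.card V : ℝ) *
      (α ^ 2 * D.zagreb + (1 - α) ^ 2 * (((D.size : ℝ) + D.closedWalksTwo) / 2)))) :
    D.lowEnergy α ≤ B ∧
    (D.lowEnergy α = B ↔
      IsStarNormal (D.alphaMatrix α) ∧
        ∀ z ∈ D.alphaSpectrum α, ∀ w ∈ D.alphaSpectrum α, |z.re| = |w.re|) ∧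
    (α = 0 → (D.lowEnergy α = B ↔
      (∀ u v : V, ¬ D.Adj u v) ∨
        ∃ k : ℕ, Fintype.card V = 2 * k ∧
          Nonempty (D.Adj ≃r (Digraph.digonUnion k).Adj))) ∧
    (0 < α → α < 1 → (D.lowEnergy α = B ↔ ∀ u v : V, ¬ D.Adj u v)) ∧
    (α = 1 → (D.lowEnergy α = B ↔ D.IsOutRegular)) := by
  have hV : 0 < Fintype.card V := by omega
  obtain ⟨hle, heq, hscalar⟩ := (D.alphaMatrix α).sum_abs_re_roots_le hV
    (Digraph.trace_alphaMatrix_add_transpose_sq hloop α) hB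
  -- All three special cases use this eigenvalue-free form of the equality condition.
  change D.lowEnergy α = B ↔ _ at hscalar
  refine ⟨hle, heq, ?_, ?_, ?_⟩
  · rintro rfl
    rw [hscalar, ← Digraph.exists_involution_iff_digonUnion]
    exact Digraph.isEmpty_or_involution_iff hloop
  · intro h0 h1
    rw [hscalar]
    refine ⟨fun ⟨_, c, hc⟩ => Digraph.isEmpty_of_scalar hloop h0 h1 hc, fun h => ?_⟩
    exact Digraph.isStarNormal_and_scalar_of_isEmpty h α
  · rintro rfl
    rw [hscalar]
    exact Digraph.isOutRegular_iff_scalar hV
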